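/- Let $n\ge 2$ and let $\mathcal M^n$ be the Euclidean space $\mathbb R^n$, the unit sphere $S^n\subset\mathbb R^{n+1}$ or the hyperbolic space $H^n$ of curvature $-1$, with geodesic distance $d$ and closed balls $B(z,r)=\{x\in\mathcal M^n: d(x,z)\le r\}$. For a nonempty bounded set $X\subset\mathcal M^n$ let $\operatorname{diam}X=\sup\{d(x,y): x,y\in X\}$. A bounded set $K\subset\mathcal M^n$ is called complete if $\operatorname{diam}(K\cup\{z\})>\operatorname{diam}K$ for every $z\in\mathcal M^n\setminus K$. Let $K\subset\mathcal M^n$ be a complete set of diameter $D>0$, where $D<\pi/2$ if $\mathcal M^n=S^n$. Then the circumradius $$R(K)=\min\{R\ge 0: K\subseteq B(z,R)\text{ for some }z\in\mathcal M^n\}$$ and the inradius $$r(K)=\max\{r\ge 0: B(z,r)\subseteq K\text{ for some }z\in\mathcal M^n\}$$ exist and satisfy $$R(K)+r(K)=D.$$ Moreover, there is a unique point $p\in\mathcal M^n$ with $K\subseteq B(p,R(K))$ (the circumcenter of $K$), there is a unique point $w\in\mathcal M^n$ with $B(w,r(K))\subseteq K$ (the center of the inscribed ball of $K$), and $w=p$.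 -/

import Mathlib

namespace ConstantCurvature

/-- The three types of simply connected spaces of constant curvature `0`, `1`, `-1`. -/
inductive Geometry : Type
  | euclidean
  | spherical
  | hyperbolic

/-- The upper sheet of the hyperboloid in `ℝⁿ⁺¹ = ℝⁿ × ℝ`: the points `(x, t)` with `t ≥ 1` and
`t² - ⟨x, x⟩ = 1`. -/
def Hyperboloid (n : ℕ) : Type :=
  {p : EuclideanSpace ℝ (Fin n) × ℝ // 1 ≤ p.2 ∧ p.2 ^ 2 - inner ℝ p.1 p.1 = 1}

/-- The form `𝓑((x, t), (y, s)) = t s - ⟨x, y⟩` on `ℝⁿ × ℝ`. -/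
noncomputable def lorentzForm {n : ℕ} (p q : EuclideanSpace ℝ (Fin n) × ℝ) : ℝ :=
  p.2 * q.2 - inner ℝ p.1 q.1

/-- The point set of `ℝⁿ`, of the unit sphere `Sⁿ ⊂ ℝⁿ⁺¹`, or of hyperbolic space `Hⁿ`. -/
def Space : Geometry → ℕ → Type
  | .euclidean, n => EuclideanSpace ℝ (Fin n)
  | .spherical, n => Metric.sphere (0 : EuclideanSpace ℝ (Fin (n + 1))) 1
  | .hyperbolic, n => Hyperboloid n

/-- The geodesic distance: the Euclidean distance in `ℝⁿ`; the angle between unit vectors in `Sⁿ`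
(that is, `arccos ⟨x, y⟩ = 2 arcsin (‖x - y‖ / 2)`, not the chordal distance);
`arcosh 𝓑(x, y)` in `Hⁿ`. -/
noncomputable def geodDist : (g : Geometry) → {n : ℕ} → Space g n → Space g n → ℝ
  | .euclidean, n => fun (x y : EuclideanSpace ℝ (Fin n)) => dist x y
  | .spherical, n => fun (x y : Metric.sphere (0 : EuclideanSpace ℝ (Fin (n + 1))) 1) =>
      InnerProductGeometry.angle (x : EuclideanSpace ℝ (Fin (n + 1))) y
  | .hyperbolic, n => fun (x y : Hyperboloid n) => Real.arcosh (lorentzForm x.1 y.1)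

variable {g : Geometry} {n : ℕ}

/-- The closed geodesic ball with center `z` and radius `r`. -/
def ball (z : Space g n) (r : ℝ) : Set (Space g n) :=
  {x | geodDist g x z ≤ r}

/-- The set of all distances between two points of `X`. -/
def distances (X : Set (Space g n)) : Set ℝ :=
  {t | ∃ x ∈ X, ∃ y ∈ X, t = geodDist g x y}

/-- The diameter, as the supremum of the distances; it is used for nonempty bounded sets only. -/
noncomputable def diam (X : Set (Space g n)) : ℝ :=
  sSup (distances X)

/-- A (diametrically) complete set: a bounded set such that adding any further point increases
the diameter. -/
def IsDiamComplete (K : Set (Space g n)) : Prop :=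
  BddAbove (distances K) ∧ ∀ z, z ∉ K → diam K < diam (insert z K)

/-- The radii `r ≥ 0` of the balls contained in `K`. -/
def innerRadii (K : Set (Space g n)) : Set ℝ :=
  {r | 0 ≤ r ∧ ∃ z, ball z r ⊆ K}

/-- The radii `r ≥ 0` of the balls containing `K`. -/
def outerRadii (K : Set (Space g n)) : Set ℝ :=
  {r | 0 ≤ r ∧ ∃ z, K ⊆ ball z r}

/-- The inradius of `K`. -/
noncomputable def inradius (K : Set (Space g n)) : ℝ :=
  sSup (innerRadii K)

/-- The circumradius of `K`. -/
noncomputable def circumradius (K : Set (Space g n)) : ℝ :=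
  sInf (outerRadii K)

/-- `p` is a circumcenter of `K`: the ball around `p` whose radius is the circumradius contains `K`. -/
def IsCircumcenter (K : Set (Space g n)) (p : Space g n) : Prop :=
  K ⊆ ball p (circumradius K)

/-- `w` is an incenter of `K`: the ball around `w` whose radius is the inradius lies in `K`. -/
def IsIncenter (K : Set (Space g n)) (w : Space g n) : Prop :=
  ball w (inradius K) ⊆ K

end ConstantCurvature

open Filter Topology

namespace ConstantCurvature

/-! Write D for the diameter. Completeness says that K is the intersection of the balls B(x, D), x ∈
K (`mem_iff_of_isDiamComplete`). If K ⊆ B(p, R), the triangle inequality therefore gives B(p, D - R)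
⊆ K. Conversely, if B(w, r) ⊆ K and x ∈ K, prolong the geodesic from x to w by r beyond w: its
endpoint is in K, so d(x, w) + r ≤ D and K ⊆ B(w, D - r) (`subset_ball_of_ball_subset`). Thus R + r
= D, and every incenter is a circumcenter.

A circumcenter exists by compactness (`subseq`). It is unique because two distinct balls of equal
radius meet in a lens lying in a strictly smaller ball (`lens`); the point `x₀` keeps the lens
nonempty. These properties are stated through distances alone and checked in each of the three
models. The scale E matters only on the sphere, where it is π/2. -/

/-- The properties of the distance that are used up to the scale `E`. -/
structure BallGeometry (g : Geometry) (n : ℕ) (E : ℝ) : Prop where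
  self : ∀ x : Space g n, geodDist g x x = 0
  symm : ∀ x y : Space g n, geodDist g x y = geodDist g y x
  triangle : ∀ x y z : Space g n, geodDist g x z ≤ geodDist g x y + geodDist g y z
  extend : ∀ (x w : Space g n) (r : ℝ), 0 ≤ r → r ≤ E → geodDist g x w ≤ E →
    ∃ y, geodDist g y w = r ∧ geodDist g x y = geodDist g x w + r
  lens : ∀ (p q x₀ : Space g n) (R : ℝ), p ≠ q → R < E → geodDist g x₀ p ≤ R →
    geodDist g x₀ q ≤ R → ∃ m, ∃ R' < R, ∀ x, geodDist g x p ≤ R → geodDist g x q ≤ R →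
      geodDist g x m ≤ R'
  subseq : ∀ (z : ℕ → Space g n) (x₀ : Space g n) (C : ℝ), (∀ k, geodDist g x₀ (z k) ≤ C) →
    ∃ z' : Space g n, ∃ φ : ℕ → ℕ, StrictMono φ ∧
      ∀ x, Tendsto (fun k => geodDist g x (z (φ k))) atTop (𝓝 (geodDist g x z'))

/-! ### The argument common to the three geometries -/

namespace BallGeometry

variable {g : Geometry} {n : ℕ} {E : ℝ}

lemma nonneg (h : BallGeometry g n E) (x y : Space g n) : 0 ≤ geodDist g x y := by
  have h1 := h.triangle x y x
  rw [h.self, h.symm y x] at h1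
  linarith

lemma mem_iff_of_isDiamComplete (h : BallGeometry g n E) {K : Set (Space g n)}
    (hK : IsDiamComplete K) (hne : K.Nonempty) (z : Space g n) :
    z ∈ K ↔ ∀ x ∈ K, geodDist g x z ≤ diam K := by
  refine ⟨fun hz x hx => le_csSup hK.1 ⟨x, hx, z, hz, rfl⟩, fun hz => ?_⟩
  by_contra hzK
  obtain ⟨x₀, hx₀⟩ := hne
  have h0 : 0 ≤ diam K := (h.nonneg x₀ z).trans (hz x₀ hx₀)
  refine (hK.2 z hzK).not_ge (csSup_le ⟨_, z, Or.inl rfl, z, Or.inl rfl, rfl⟩ ?_)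
  rintro t ⟨x, rfl | hx, y, rfl | hy, rfl⟩
  · rwa [h.self]
  · rw [h.symm]; exact hz y hy
  · exact hz x hx
  · exact le_csSup hK.1 ⟨x, hx, y, hy, rfl⟩

/-- Centers of balls with radii tending to the infimum subconverge, and the bounds on the distances
pass to the limit. -/
lemma exists_isCircumcenter (h : BallGeometry g n E) {K : Set (Space g n)} (hne : K.Nonempty)
    (hR : (outerRadii K).Nonempty) : ∃ p, IsCircumcenter K p := by
  have hbdd : BddBelow (outerRadii K) := ⟨0, fun r hr => hr.1⟩
  obtain ⟨x₀, hx₀⟩ := hne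
  have hex : ∀ k : ℕ, ∃ z : Space g n, ∀ x ∈ K,
      geodDist g x z ≤ circumradius K + 1 / ((k : ℝ) + 1) := by
    intro k
    obtain ⟨r, ⟨_, z, hz⟩, hlt⟩ := exists_lt_of_csInf_lt hR
      (lt_add_of_pos_right (circumradius K) (Nat.one_div_pos_of_nat (n := k)))
    exact ⟨z, fun x hx => le_trans (hz hx) hlt.le⟩
  choose z hz using hex
  obtain ⟨p, φ, hφ, hlim⟩ := h.subseq z x₀ (circumradius K + 1) (fun k =>
    (hz k x₀ hx₀).trans (by
      gcongr
      rw [div_le_one (by positivity)]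
      linarith [(Nat.cast_nonneg k : (0 : ℝ) ≤ k)]))
  refine ⟨p, fun x hx => ?_⟩
  have hl : Tendsto (fun k => circumradius K + 1 / (((φ k : ℕ) : ℝ) + 1)) atTop
      (𝓝 (circumradius K + 0)) :=
    tendsto_const_nhds.add (tendsto_one_div_add_atTop_nhds_zero_nat.comp hφ.tendsto_atTop)
  rw [add_zero] at hl
  exact le_of_tendsto_of_tendsto' (hlim x) hl (fun k => hz (φ k) x hx)

lemma isCircumcenter_unique (h : BallGeometry g n E) {K : Set (Space g n)} (hne : K.Nonempty)
    (hE : circumradius K < E) {p q : Space g n} (hp : IsCircumcenter K p)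
    (hq : IsCircumcenter K q) : q = p := by
  by_contra hqp
  obtain ⟨x₀, hx₀⟩ := hne
  obtain ⟨m, R', hlt, hm⟩ := h.lens q p x₀ _ hqp hE (hq hx₀) (hp hx₀)
  have hmem : R' ∈ outerRadii K :=
    ⟨(h.nonneg x₀ m).trans (hm x₀ (hq hx₀) (hp hx₀)), m, fun x hx => hm x (hq hx) (hp hx)⟩
  exact hlt.not_ge (csInf_le ⟨0, fun r hr => hr.1⟩ hmem)

/-- A ball inside a set of diameter `D` yields a concentric ball around the set. -/
lemma subset_ball_of_ball_subset (h : BallGeometry g n E) {K : Set (Space g n)}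
    (hbdd : BddAbove (distances K)) (hE : diam K < E) {w : Space g n} {r : ℝ} (hr : 0 ≤ r)
    (hw : ball w r ⊆ K) : r ≤ diam K ∧ K ⊆ ball w (diam K - r) := by
  have hdist : ∀ {x y}, x ∈ K → y ∈ K → geodDist g x y ≤ diam K :=
    fun hx hy => le_csSup hbdd ⟨_, hx, _, hy, rfl⟩
  have hwK : w ∈ K := hw (show geodDist g w w ≤ r by rwa [h.self])
  have hD : 0 ≤ diam K := (h.nonneg w w).trans (hdist hwK hwK)
  have hrD : r ≤ diam K := by
    by_contra! hlt
    -- Extension is available only up to E, hence the truncation; `min r E` still exceeds the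
    -- diameter.
    obtain ⟨y, hy, -⟩ := h.extend w w (min r E) (le_min hr (hD.trans hE.le)) (min_le_right _ _)
      (by rw [h.self]; exact hD.trans hE.le)
    have hyK : y ∈ K := hw (hy.trans_le (min_le_left _ _))
    have := hdist hyK hwK
    rw [hy] at this
    exact (lt_min hlt hE).not_ge this
  refine ⟨hrD, fun x hx => ?_⟩
  -- The point of the ball opposite to x, at distance d(x, w) + r from x.
  obtain ⟨y, hy, hxy⟩ := h.extend x w r hr (hrD.trans hE.le) ((hdist hx hwK).trans hE.le)
  have := hdist hx (hw (show geodDist g y w ≤ r from hy.le))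
  show geodDist g x w ≤ diam K - r
  linarith

theorem circumradius_add_inradius (h : BallGeometry g n E) {K : Set (Space g n)}
    (hK : IsDiamComplete K) (hne : K.Nonempty) (hE : diam K < E) :
    IsLeast (outerRadii K) (circumradius K) ∧ IsGreatest (innerRadii K) (inradius K) ∧
    circumradius K + inradius K = diam K ∧
    ∃ p : Space g n, IsCircumcenter K p ∧ (∀ q, IsCircumcenter K q → q = p) ∧
      IsIncenter K p ∧ (∀ w, IsIncenter K w → w = p) := by
  have hmem := h.mem_iff_of_isDiamComplete hK hne
  obtain ⟨x₀, hx₀⟩ := id hne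
  have hDmem : diam K ∈ outerRadii K :=
    ⟨(h.nonneg x₀ x₀).trans ((hmem x₀).1 hx₀ x₀ hx₀), x₀, fun x hx => (hmem x₀).1 hx₀ x hx⟩
  have hbelow : BddBelow (outerRadii K) := ⟨0, fun r hr => hr.1⟩
  have hRD : circumradius K ≤ diam K := csInf_le hbelow hDmem
  obtain ⟨p, hp⟩ := h.exists_isCircumcenter hne ⟨_, hDmem⟩
  have hR0 : 0 ≤ circumradius K := (h.nonneg x₀ p).trans (hp hx₀)
  have hinner : ball p (diam K - circumradius K) ⊆ K := by
    intro z hz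
    refine (hmem z).2 fun x hx => ?_
    have h1 : geodDist g x p ≤ circumradius K := hp hx
    have h2 : geodDist g z p ≤ diam K - circumradius K := hz
    have h3 := h.triangle x p z
    rw [h.symm p z] at h3
    linarith
  have houter : ∀ r ∈ innerRadii K, r ≤ diam K - circumradius K := by
    rintro r ⟨hr, w, hw⟩
    obtain ⟨hrD, hsub⟩ := h.subset_ball_of_ball_subset hK.1 hE hr hw
    have := csInf_le hbelow (show diam K - r ∈ outerRadii K from ⟨by linarith, w, hsub⟩)
    change circumradius K ≤ _ at this
    linarith
  have hgreat : IsGreatest (innerRadii K) (diam K - circumradius K) :=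
    ⟨⟨by linarith, p, hinner⟩, houter⟩
  have hin : inradius K = diam K - circumradius K := hgreat.csSup_eq
  have huniq : ∀ q, IsCircumcenter K q → q = p := fun q hq =>
    h.isCircumcenter_unique hne (hRD.trans_lt hE) hp hq
  refine ⟨⟨⟨hR0, p, hp⟩, fun r hr => csInf_le hbelow hr⟩, hin ▸ hgreat, by rw [hin]; ring,
    p, hp, huniq, ?_, fun w hw => huniq w ?_⟩
  · rwa [IsIncenter, hin]
  -- An incenter is a circumcenter, since D - (D - R) = R.
  · have hw' : ball w (diam K - circumradius K) ⊆ K := hin ▸ hw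
    have := (h.subset_ball_of_ball_subset hK.1 hE (by linarith) hw').2
    rwa [sub_sub_cancel] at this

end BallGeometry

/-! ### Euclidean space -/

section Euclidean

variable {V : Type*} [NormedAddCommGroup V] [InnerProductSpace ℝ V]

lemma exists_unit_smul_eq [Nontrivial V] (v : V) : ∃ u : V, ‖u‖ = 1 ∧ v = ‖v‖ • u := by
  rcases eq_or_ne v 0 with rfl | hv
  · obtain ⟨u, hu⟩ := exists_norm_eq V zero_le_one
    exact ⟨u, hu, by simp⟩
  · exact ⟨‖v‖⁻¹ • v, norm_smul_inv_norm hv, by rw [smul_inv_smul₀ (norm_ne_zero_iff.2 hv)]⟩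

/-- The parallelogram law; it puts a lens in a smaller ball about the midpoint. -/
lemma norm_sub_midpoint_sq (x p q : V) :
    ‖x - midpoint ℝ p q‖ ^ 2 = (‖x - p‖ ^ 2 + ‖x - q‖ ^ 2) / 2 - ‖p - q‖ ^ 2 / 4 := by
  have h1 : x - midpoint ℝ p q = (1 / 2 : ℝ) • ((x - p) + (x - q)) := by
    rw [midpoint_eq_smul_add, invOf_eq_inv]; module
  have h2 : p - q = (x - q) - (x - p) := by abel
  rw [h1, h2, norm_smul, mul_pow, norm_add_sq_real, norm_sub_sq_real (x - q) (x - p),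
    real_inner_comm (x - p) (x - q)]
  norm_num
  ring

end Euclidean

lemma ballGeometry_euclidean {n : ℕ} (hn : 1 ≤ n) (E : ℝ) : BallGeometry .euclidean n E := by
  have : Nontrivial (EuclideanSpace ℝ (Fin n)) :=
    Module.nontrivial_of_finrank_pos (R := ℝ) (by rw [finrank_euclideanSpace_fin]; omega)
  refine ⟨fun x => dist_self (α := EuclideanSpace ℝ (Fin n)) x,
    fun x y => dist_comm (α := EuclideanSpace ℝ (Fin n)) x y,
    fun x y z => dist_triangle (α := EuclideanSpace ℝ (Fin n)) x y z, ?_, ?_, ?_⟩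
  · intro (x : EuclideanSpace ℝ (Fin n)) (w : EuclideanSpace ℝ (Fin n)) r hr _ _
    obtain ⟨u, hu, hxw⟩ := exists_unit_smul_eq (x - w)
    have h1 : x - (w - r • u) = (‖x - w‖ + r) • u := by
      rw [add_smul, ← hxw]; abel
    refine ⟨(w - r • u : EuclideanSpace ℝ (Fin n)), ?_, ?_⟩
    · change dist (w - r • u) w = r
      simp [norm_smul, hu, abs_of_nonneg hr]
    · change dist x (w - r • u) = dist x w + r
      rw [dist_eq_norm, dist_eq_norm, h1, norm_smul, hu, mul_one, Real.norm_of_nonneg]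
      positivity
  · intro (p : EuclideanSpace ℝ (Fin n)) (q : EuclideanSpace ℝ (Fin n))
      (x₀ : EuclideanSpace ℝ (Fin n)) R hpq _ hp hq
    change dist x₀ p ≤ R at hp
    change dist x₀ q ≤ R at hq
    have hd : 0 < ‖p - q‖ := norm_pos_iff.2 (sub_ne_zero.2 hpq)
    have hR : 0 < R := by
      have := dist_triangle_left p q x₀
      rw [dist_eq_norm] at this
      linarith
    refine ⟨(midpoint ℝ p q : EuclideanSpace ℝ (Fin n)), √(R ^ 2 - ‖p - q‖ ^ 2 / 4),
      (Real.sqrt_lt' hR).2 (by nlinarith), fun (x : EuclideanSpace ℝ (Fin n)) hxp hxq => ?_⟩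
    change dist x p ≤ R at hxp
    change dist x q ≤ R at hxq
    change dist x (midpoint ℝ p q) ≤ _
    rw [dist_eq_norm] at *
    refine Real.le_sqrt_of_sq_le ?_
    rw [norm_sub_midpoint_sq]
    have h1 := pow_le_pow_left₀ (norm_nonneg _) hxp 2
    have h2 := pow_le_pow_left₀ (norm_nonneg _) hxq 2
    linarith
  · intro (z : ℕ → EuclideanSpace ℝ (Fin n)) (x₀ : EuclideanSpace ℝ (Fin n)) C hC
    obtain ⟨a, -, φ, hφ, ha⟩ := tendsto_subseq_of_bounded (Metric.isBounded_closedBall (x := x₀)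
      (r := C)) (x := z) (fun k => by rw [Metric.mem_closedBall, dist_comm]; exact hC k)
    exact ⟨a, φ, hφ, fun (x : EuclideanSpace ℝ (Fin n)) => tendsto_const_nhds.dist ha⟩

/-! ### The sphere -/

section Sphere

variable {V : Type*} [NormedAddCommGroup V] [InnerProductSpace ℝ V]

lemma angle_eq_arccos_inner {x y : V} (hx : ‖x‖ = 1) (hy : ‖y‖ = 1) :
    InnerProductGeometry.angle x y = Real.arccos (inner ℝ x y) := by
  rw [InnerProductGeometry.angle, hx, hy, mul_one, div_one]

lemma cos_angle_eq_inner {x y : V} (hx : ‖x‖ = 1) (hy : ‖y‖ = 1) :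
    Real.cos (InnerProductGeometry.angle x y) = inner ℝ x y := by
  rw [InnerProductGeometry.cos_angle, hx, hy, mul_one, div_one]

/-- Polar coordinates around `w` on the unit sphere. -/
lemma exists_polar [FiniteDimensional ℝ V] (hV : 2 ≤ Module.finrank ℝ V) {x w : V}
    (hx : ‖x‖ = 1) (hw : ‖w‖ = 1) (hxw : 0 ≤ inner ℝ x w) :
    ∃ u : V, ‖u‖ = 1 ∧ inner ℝ u w = 0 ∧
      x = Real.cos (InnerProductGeometry.angle x w) • w
        + Real.sin (InnerProductGeometry.angle x w) • u := by
  set a := InnerProductGeometry.angle x w with ha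
  have hcos : Real.cos a = inner ℝ x w := cos_angle_eq_inner hx hw
  have hxx : inner ℝ x x = (1 : ℝ) := by rw [real_inner_self_eq_norm_sq, hx, one_pow]
  have hww : inner ℝ w w = (1 : ℝ) := by rw [real_inner_self_eq_norm_sq, hw, one_pow]
  by_cases hs : Real.sin a = 0
  -- The sign of ⟨x, w⟩ excludes x = -w, so x = w and any unit vector orthogonal to w serves.
  · have hc : Real.cos a = 1 := by nlinarith [Real.sin_sq_add_cos_sq a]
    have hxw' : x = w := (inner_eq_one_iff_of_norm_eq_one hx hw).1 (hcos ▸ hc)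
    have h1 := Submodule.finrank_add_finrank_orthogonal (ℝ ∙ w)
    rw [finrank_span_singleton (norm_ne_zero_iff.1 (by rw [hw]; exact one_ne_zero))] at h1
    have : Nontrivial (ℝ ∙ w)ᗮ := Module.nontrivial_of_finrank_pos (R := ℝ) (by omega)
    obtain ⟨u, hu⟩ := exists_norm_eq (ℝ ∙ w)ᗮ zero_le_one
    exact ⟨u, by simpa using hu, Submodule.mem_orthogonal_singleton_iff_inner_left.1 u.2,
      by rw [hs, hc, hxw']; simp⟩
  · refine ⟨(Real.sin a)⁻¹ • (x - Real.cos a • w), ?_, ?_, ?_⟩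
    · rw [← sq_eq_sq₀ (norm_nonneg _) zero_le_one, ← real_inner_self_eq_norm_sq]
      simp only [inner_smul_left, inner_smul_right, inner_sub_left, inner_sub_right, hxx, hww,
        real_inner_comm x w, ← hcos, conj_trivial]
      field_simp
      linarith [Real.sin_sq_add_cos_sq a]
    · simp only [inner_smul_left, inner_sub_left, hww, ← hcos, conj_trivial]
      ring
    · rw [smul_inv_smul₀ hs]; abel

end Sphere

lemma ballGeometry_spherical {n : ℕ} (hn : 1 ≤ n) :
    BallGeometry .spherical n (Real.pi / 2) := by
  have nrm : ∀ x : Metric.sphere (0 : EuclideanSpace ℝ (Fin (n + 1))) 1,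
      ‖(x : EuclideanSpace ℝ (Fin (n + 1)))‖ = 1 := fun x => by simp
  refine ⟨?_, ?_, ?_, ?_, ?_, ?_⟩
  · intro (x : Metric.sphere (0 : EuclideanSpace ℝ (Fin (n + 1))) 1)
    exact InnerProductGeometry.angle_self (by rw [← norm_ne_zero_iff, nrm]; exact one_ne_zero)
  · intro (x : Metric.sphere (0 : EuclideanSpace ℝ (Fin (n + 1))) 1)
      (y : Metric.sphere (0 : EuclideanSpace ℝ (Fin (n + 1))) 1)
    exact InnerProductGeometry.angle_comm _ _
  · intro (x : Metric.sphere (0 : EuclideanSpace ℝ (Fin (n + 1))) 1)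
      (y : Metric.sphere (0 : EuclideanSpace ℝ (Fin (n + 1))) 1)
      (z : Metric.sphere (0 : EuclideanSpace ℝ (Fin (n + 1))) 1)
    exact InnerProductGeometry.angle_le_angle_add_angle _ _ _
  · intro (x : Metric.sphere (0 : EuclideanSpace ℝ (Fin (n + 1))) 1)
      (w : Metric.sphere (0 : EuclideanSpace ℝ (Fin (n + 1))) 1) r hr hrE hxw
    obtain ⟨x, hx⟩ := x
    obtain ⟨w, hw⟩ := w
    rw [mem_sphere_zero_iff_norm] at hx hw
    change InnerProductGeometry.angle x w ≤ _ at hxw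
    obtain ⟨u, hu, huw, hpol⟩ := exists_polar (by simpa using hn) hx hw
      (by
        rw [← cos_angle_eq_inner hx hw]
        exact Real.cos_nonneg_of_neg_pi_div_two_le_of_le
          (by linarith [InnerProductGeometry.angle_nonneg x w]) hxw)
    have hww : inner ℝ w w = (1 : ℝ) := by rw [real_inner_self_eq_norm_sq, hw, one_pow]
    have huu : inner ℝ u u = (1 : ℝ) := by rw [real_inner_self_eq_norm_sq, hu, one_pow]
    have hwu : inner ℝ w u = (0 : ℝ) := by rw [real_inner_comm, huw]
    set a := InnerProductGeometry.angle x w with ha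
    have ha0 : 0 ≤ a := InnerProductGeometry.angle_nonneg _ _
    have hy : ‖Real.cos r • w - Real.sin r • u‖ = 1 := by
      rw [← sq_eq_sq₀ (norm_nonneg _) zero_le_one, ← real_inner_self_eq_norm_sq]
      simp only [inner_smul_left, inner_smul_right, inner_sub_left, inner_sub_right, huu, hww,
        huw, hwu, conj_trivial]
      linarith [Real.sin_sq_add_cos_sq r]
    refine ⟨(⟨Real.cos r • w - Real.sin r • u, mem_sphere_zero_iff_norm.2 hy⟩ :
      Metric.sphere (0 : EuclideanSpace ℝ (Fin (n + 1))) 1), ?_, ?_⟩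
    · change InnerProductGeometry.angle (Real.cos r • w - Real.sin r • u) w = r
      rw [angle_eq_arccos_inner hy hw, inner_sub_left, inner_smul_left, inner_smul_left, hww, huw]
      simp [Real.arccos_cos hr (by linarith)]
    · change InnerProductGeometry.angle x (Real.cos r • w - Real.sin r • u) = a + r
      -- Both a and r are at most π/2, so a + r ≤ π and `arccos` recovers it.
      rw [angle_eq_arccos_inner hx hy, hpol, ← Real.arccos_cos (x := a + r) (by linarith)
        (by linarith), Real.cos_add]
      congr 1
      simp only [inner_smul_left, inner_smul_right, inner_sub_right, inner_add_left, huu, hww,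
        huw, hwu, conj_trivial]
      ring
  · intro (p : Metric.sphere (0 : EuclideanSpace ℝ (Fin (n + 1))) 1)
      (q : Metric.sphere (0 : EuclideanSpace ℝ (Fin (n + 1))) 1)
      (x₀ : Metric.sphere (0 : EuclideanSpace ℝ (Fin (n + 1))) 1) R hpq hR hp₀ hq₀
    have hcos : ∀ x y : Metric.sphere (0 : EuclideanSpace ℝ (Fin (n + 1))) 1,
        InnerProductGeometry.angle (x : EuclideanSpace ℝ (Fin (n + 1))) y ≤ R →
        Real.cos R ≤ inner ℝ (x : EuclideanSpace ℝ (Fin (n + 1))) y := by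
      intro x y hxy
      rw [← cos_angle_eq_inner (nrm x) (nrm y)]
      exact Real.cos_le_cos_of_nonneg_of_le_pi (InnerProductGeometry.angle_nonneg _ _)
        (by linarith [Real.pi_pos]) hxy
    have hR0 : 0 ≤ R := (InnerProductGeometry.angle_nonneg _ _).trans hp₀
    have hRpos : 0 < Real.cos R := Real.cos_pos_of_mem_Ioo ⟨by linarith [Real.pi_pos], hR⟩
    -- The new center is the normalized sum. The point `x₀` has positive inner product with p and q,
    -- so they are not antipodal; p ≠ q makes ‖s‖ < 2, which improves the bound cos R.
    set s : EuclideanSpace ℝ (Fin (n + 1)) := p + q with hs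
    have hs0 : 0 < ‖s‖ := by
      rw [norm_pos_iff]
      intro h0
      have h1 : inner ℝ (x₀ : EuclideanSpace ℝ (Fin (n + 1))) s = 0 := by rw [h0, inner_zero_right]
      rw [hs, inner_add_right] at h1
      linarith [hcos x₀ p hp₀, hcos x₀ q hq₀]
    have hs2 : ‖s‖ < 2 := by
      have h1 : inner ℝ (p : EuclideanSpace ℝ (Fin (n + 1))) q < 1 :=
        (inner_lt_one_iff_real_of_norm_eq_one (nrm p) (nrm q)).2 fun h => hpq (Subtype.ext h)
      have h2 := norm_add_sq_real (p : EuclideanSpace ℝ (Fin (n + 1))) q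
      rw [nrm, nrm] at h2
      refine lt_of_pow_lt_pow_left₀ 2 (by norm_num) ?_
      rw [hs, h2]
      linarith
    have hm : ‖‖s‖⁻¹ • s‖ = 1 := norm_smul_inv_norm (norm_pos_iff.1 hs0)
    have hlt : Real.cos R < 2 * Real.cos R / ‖s‖ := by
      rw [lt_div_iff₀ hs0]; nlinarith
    have hle : ∀ x : Metric.sphere (0 : EuclideanSpace ℝ (Fin (n + 1))) 1,
        InnerProductGeometry.angle (x : EuclideanSpace ℝ (Fin (n + 1))) p ≤ R →
        InnerProductGeometry.angle (x : EuclideanSpace ℝ (Fin (n + 1))) q ≤ R →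
        2 * Real.cos R / ‖s‖ ≤ inner ℝ (x : EuclideanSpace ℝ (Fin (n + 1))) (‖s‖⁻¹ • s) := by
      intro x hxp hxq
      rw [inner_smul_right, hs, inner_add_right, ← hs, div_eq_inv_mul]
      gcongr
      linarith [hcos x p hxp, hcos x q hxq]
    refine ⟨(⟨‖s‖⁻¹ • s, mem_sphere_zero_iff_norm.2 hm⟩ :
      Metric.sphere (0 : EuclideanSpace ℝ (Fin (n + 1))) 1),
      Real.arccos (2 * Real.cos R / ‖s‖), ?_, ?_⟩
    · have h1 : 2 * Real.cos R / ‖s‖ ≤ 1 := (hle x₀ hp₀ hq₀).trans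
        ((real_inner_le_norm _ _).trans (by rw [nrm, hm, mul_one]))
      have h2 := Real.arccos_lt_arccos (by linarith) hlt h1
      rwa [Real.arccos_cos hR0 (by linarith [Real.pi_pos])] at h2
    · intro (x : Metric.sphere (0 : EuclideanSpace ℝ (Fin (n + 1))) 1) hxp hxq
      change InnerProductGeometry.angle (x : EuclideanSpace ℝ (Fin (n + 1))) (‖s‖⁻¹ • s) ≤ _
      rw [angle_eq_arccos_inner (nrm x) hm]
      exact Real.arccos_le_arccos (hle x hxp hxq)
  · intro (z : ℕ → Metric.sphere (0 : EuclideanSpace ℝ (Fin (n + 1))) 1) _ _ _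
    obtain ⟨a, -, φ, hφ, ha⟩ := isCompact_univ.tendsto_subseq (x := z) fun k => Set.mem_univ _
    refine ⟨a, φ, hφ, fun (x : Metric.sphere (0 : EuclideanSpace ℝ (Fin (n + 1))) 1) => ?_⟩
    have hc : Continuous fun y : Metric.sphere (0 : EuclideanSpace ℝ (Fin (n + 1))) 1 =>
        InnerProductGeometry.angle (x : EuclideanSpace ℝ (Fin (n + 1))) y := by
      simp only [angle_eq_arccos_inner (nrm x) (nrm _)]
      exact Real.continuous_arccos.comp (continuous_const.inner continuous_subtype_val)
    exact (hc.tendsto a).comp ha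

/-! ### Hyperbolic space: the hyperboloid model -/

section Hyperbolic

variable {n : ℕ}

lemma lorentzForm_comm (p q : EuclideanSpace ℝ (Fin n) × ℝ) :
    lorentzForm p q = lorentzForm q p := by
  rw [lorentzForm, lorentzForm, real_inner_comm, mul_comm]

lemma lorentzForm_add_left (p q r : EuclideanSpace ℝ (Fin n) × ℝ) :
    lorentzForm (p + q) r = lorentzForm p r + lorentzForm q r := by
  simp only [lorentzForm, Prod.fst_add, Prod.snd_add, inner_add_left]; ring

lemma lorentzForm_sub_left (p q r : EuclideanSpace ℝ (Fin n) × ℝ) :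
    lorentzForm (p - q) r = lorentzForm p r - lorentzForm q r := by
  simp only [lorentzForm, Prod.fst_sub, Prod.snd_sub, inner_sub_left]; ring

lemma lorentzForm_smul_left (c : ℝ) (p r : EuclideanSpace ℝ (Fin n) × ℝ) :
    lorentzForm (c • p) r = c * lorentzForm p r := by
  simp only [lorentzForm, Prod.smul_fst, Prod.smul_snd, inner_smul_left, smul_eq_mul,
    conj_trivial]; ring

lemma lorentzForm_add_right (p q r : EuclideanSpace ℝ (Fin n) × ℝ) :
    lorentzForm r (p + q) = lorentzForm r p + lorentzForm r q := by
  simp only [lorentzForm_comm r, lorentzForm_add_left]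

lemma lorentzForm_sub_right (p q r : EuclideanSpace ℝ (Fin n) × ℝ) :
    lorentzForm r (p - q) = lorentzForm r p - lorentzForm r q := by
  simp only [lorentzForm_comm r, lorentzForm_sub_left]

lemma lorentzForm_smul_right (c : ℝ) (p r : EuclideanSpace ℝ (Fin n) × ℝ) :
    lorentzForm r (c • p) = c * lorentzForm r p := by
  simp only [lorentzForm_comm r, lorentzForm_smul_left]

lemma continuous_lorentzForm_right (p : EuclideanSpace ℝ (Fin n) × ℝ) :
    Continuous (lorentzForm p) := by
  unfold lorentzForm
  fun_prop

namespace Hyperboloid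

lemma form_self (x : Hyperboloid n) : lorentzForm x.1 x.1 = 1 := by
  rw [lorentzForm, ← sq]; exact x.2.2

lemma sq_height (x : Hyperboloid n) : x.1.2 ^ 2 = 1 + ‖x.1.1‖ ^ 2 := by
  have := x.2.2
  rw [real_inner_self_eq_norm_sq] at this
  linarith

lemma norm_lt_height (x : Hyperboloid n) : ‖x.1.1‖ < x.1.2 :=
  lt_of_pow_lt_pow_left₀ 2 (by linarith [x.2.1]) (by linarith [x.sq_height])

/-- A vector of length one in the future cone is a point of the hyperboloid. -/
lemma mem_of_pos {v : EuclideanSpace ℝ (Fin n) × ℝ} (hv : lorentzForm v v = 1) (h0 : 0 < v.2) :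
    1 ≤ v.2 ∧ v.2 ^ 2 - inner ℝ v.1 v.1 = 1 := by
  rw [lorentzForm, ← sq] at hv
  have h1 : 0 ≤ inner ℝ v.1 v.1 := real_inner_self_nonneg
  exact ⟨by nlinarith, hv⟩

/-- A timelike vector in the past cone pairs negatively with every point of the upper sheet. -/
lemma height_pos_of_form_pos {v : EuclideanSpace ℝ (Fin n) × ℝ} (hv : lorentzForm v v = 1)
    (w : Hyperboloid n) (h : 0 < lorentzForm v w.1) : 0 < v.2 := by
  by_contra! hle
  rw [lorentzForm, real_inner_self_eq_norm_sq] at hv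
  rw [lorentzForm] at h
  have h1 : ‖v.1‖ ≤ -v.2 := by
    by_contra! hlt
    nlinarith
  have h2 := mul_le_mul h1 w.norm_lt_height.le (norm_nonneg _) (by linarith)
  have h3 := (abs_le.1 (abs_real_inner_le_norm v.1 w.1.1)).1
  linarith

/-- The form is negative definite on the orthogonal complement of a point of the hyperboloid. -/
lemma form_self_le_of_orthogonal (y : Hyperboloid n) {u : EuclideanSpace ℝ (Fin n) × ℝ}
    (hu : lorentzForm u y.1 = 0) : ‖u.1‖ ^ 2 ≤ -lorentzForm u u * y.1.2 ^ 2 := by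
  rw [lorentzForm, sub_eq_zero] at hu
  -- Cauchy-Schwarz in ℝⁿ; orthogonality replaces the left side by the product of the heights.
  have h1 : (inner ℝ u.1 y.1.1) ^ 2 ≤ (‖u.1‖ * ‖y.1.1‖) ^ 2 :=
    sq_le_sq' (abs_le.1 (abs_real_inner_le_norm _ _)).1 (real_inner_le_norm _ _)
  rw [← hu, mul_pow, mul_pow, show ‖y.1.1‖ ^ 2 = y.1.2 ^ 2 - 1 by linarith [y.sq_height]] at h1
  rw [lorentzForm, real_inner_self_eq_norm_sq]
  linarith

lemma form_self_nonpos_of_orthogonal (y : Hyperboloid n) {u : EuclideanSpace ℝ (Fin n) × ℝ}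
    (hu : lorentzForm u y.1 = 0) : lorentzForm u u ≤ 0 := by
  have h1 := y.form_self_le_of_orthogonal hu
  have h2 : 0 < y.1.2 ^ 2 := by have := y.2.1; positivity
  by_contra! h
  nlinarith [sq_nonneg ‖u.1‖, mul_pos h h2]

lemma eq_zero_of_orthogonal (y : Hyperboloid n) {u : EuclideanSpace ℝ (Fin n) × ℝ}
    (hu : lorentzForm u y.1 = 0) (h0 : lorentzForm u u = 0) : u = 0 := by
  have h1 := y.form_self_le_of_orthogonal hu
  rw [h0, neg_zero, zero_mul] at h1
  have h2 : u.1 = 0 := norm_eq_zero.1 (pow_eq_zero_iff two_ne_zero |>.1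
    (le_antisymm h1 (sq_nonneg _)))
  rw [lorentzForm, h2, inner_zero_left, sub_zero] at hu
  have h3 : u.2 = 0 := (mul_eq_zero.1 hu).resolve_right (by linarith [y.2.1])
  exact Prod.ext h2 h3

lemma form_sub_smul_self (x y : Hyperboloid n) :
    lorentzForm (x.1 - lorentzForm x.1 y.1 • y.1) y.1 = 0 := by
  rw [lorentzForm_sub_left, lorentzForm_smul_left, form_self]; ring

lemma form_residual (x y : Hyperboloid n) :
    lorentzForm (x.1 - lorentzForm x.1 y.1 • y.1) (x.1 - lorentzForm x.1 y.1 • y.1)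
      = 1 - lorentzForm x.1 y.1 ^ 2 := by
  rw [lorentzForm_sub_right, lorentzForm_smul_right, form_sub_smul_self, lorentzForm_sub_left,
    lorentzForm_smul_left, form_self, lorentzForm_comm y.1 x.1]; ring

lemma one_le_form (x y : Hyperboloid n) : 1 ≤ lorentzForm x.1 y.1 := by
  have h1 := y.form_self_nonpos_of_orthogonal (x.form_sub_smul_self y)
  rw [form_residual] at h1
  have h2 : 0 < lorentzForm x.1 y.1 := by
    rw [lorentzForm]
    have := mul_lt_mul'' x.norm_lt_height y.norm_lt_height (norm_nonneg _) (norm_nonneg _)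
    linarith [real_inner_le_norm x.1.1 y.1.1]
  nlinarith

lemma one_lt_form {x y : Hyperboloid n} (h : x ≠ y) : 1 < lorentzForm x.1 y.1 := by
  refine (one_le_form x y).lt_of_ne' fun h1 => h (Subtype.ext ?_)
  have h2 := y.eq_zero_of_orthogonal (x.form_sub_smul_self y) (by rw [form_residual, h1]; ring)
  rwa [h1, one_smul, sub_eq_zero] at h2

/-- The reversed Cauchy-Schwarz inequality on the orthogonal complement of `y`. -/
lemma sq_form_sub_le (x y z : Hyperboloid n) :
    (lorentzForm x.1 z.1 - lorentzForm x.1 y.1 * lorentzForm z.1 y.1) ^ 2 ≤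
      (lorentzForm x.1 y.1 ^ 2 - 1) * (lorentzForm z.1 y.1 ^ 2 - 1) := by
  set u := x.1 - lorentzForm x.1 y.1 • y.1 with hu
  set v := z.1 - lorentzForm z.1 y.1 • y.1 with hv
  have huu : lorentzForm u u = 1 - lorentzForm x.1 y.1 ^ 2 := x.form_residual y
  have hvv : lorentzForm v v = 1 - lorentzForm z.1 y.1 ^ 2 := z.form_residual y
  have huv : lorentzForm u v
      = lorentzForm x.1 z.1 - lorentzForm x.1 y.1 * lorentzForm z.1 y.1 := by
    rw [hv, lorentzForm_sub_right, lorentzForm_smul_right, hu, form_sub_smul_self,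
      lorentzForm_sub_left, lorentzForm_smul_left, lorentzForm_comm y.1 z.1]
    ring
  -- The form is nonpositive at u + t v for all t, so the discriminant of this quadratic is
  -- nonpositive.
  have hq : ∀ t : ℝ, 0 ≤ (-lorentzForm v v) * (t * t) + (-2 * lorentzForm u v) * t
      + -lorentzForm u u := by
    intro t
    have h1 : lorentzForm (u + t • v) y.1 = 0 := by
      rw [lorentzForm_add_left, lorentzForm_smul_left, hu, hv, form_sub_smul_self,
        form_sub_smul_self]; ring
    have h2 := y.form_self_nonpos_of_orthogonal h1
    simp only [lorentzForm_add_left, lorentzForm_smul_left, lorentzForm_add_right,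
      lorentzForm_smul_right, lorentzForm_comm v u] at h2
    linarith
  have hd := discrim_le_zero hq
  rw [discrim, huu, hvv, huv] at hd
  linarith

lemma cosh_dist (x y : Hyperboloid n) :
    Real.cosh (Real.arcosh (lorentzForm x.1 y.1)) = lorentzForm x.1 y.1 :=
  Real.cosh_arcosh (one_le_form x y)

/-- By the addition formula for cosh this is `sq_form_sub_le` after taking a square root. -/
lemma arcosh_triangle (x y z : Hyperboloid n) :
    Real.arcosh (lorentzForm x.1 z.1) ≤
      Real.arcosh (lorentzForm x.1 y.1) + Real.arcosh (lorentzForm y.1 z.1) := by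
  have h1 := one_le_form x y
  have h2 := one_le_form y z
  have h3 := sq_form_sub_le x y z
  rw [lorentzForm_comm z.1 y.1] at h3
  rw [← Real.arcosh_cosh (add_nonneg (Real.arcosh_nonneg h1) (Real.arcosh_nonneg h2)),
    Real.arcosh_le_arcosh (by linarith [one_le_form x z]) (Real.cosh_pos _), Real.cosh_add,
    cosh_dist, cosh_dist, Real.sinh_arcosh h1, Real.sinh_arcosh h2,
    ← Real.sqrt_mul (by nlinarith)]
  linarith [Real.le_sqrt_of_sq_le h3]

lemma exists_ne (hn : 1 ≤ n) (w : Hyperboloid n) : ∃ x : Hyperboloid n, x ≠ w := by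
  have : Nontrivial (EuclideanSpace ℝ (Fin n)) :=
    Module.nontrivial_of_finrank_pos (R := ℝ) (by rw [finrank_euclideanSpace_fin]; omega)
  obtain ⟨v, hv⟩ := _root_.exists_ne w.1.1
  have h0 : 0 < 1 + ‖v‖ ^ 2 := by positivity
  refine ⟨⟨(v, √(1 + ‖v‖ ^ 2)), mem_of_pos ?_ (Real.sqrt_pos.2 h0)⟩, fun h => hv ?_⟩
  · rw [lorentzForm, real_inner_self_eq_norm_sq]
    change √(1 + ‖v‖ ^ 2) * √(1 + ‖v‖ ^ 2) - ‖v‖ ^ 2 = 1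
    rw [Real.mul_self_sqrt h0.le]; ring
  · rw [← h]

lemma exists_polar_of_ne {x w : Hyperboloid n} (h : x ≠ w) :
    ∃ u, lorentzForm u u = -1 ∧ lorentzForm u w.1 = 0 ∧
      x.1 = Real.cosh (Real.arcosh (lorentzForm x.1 w.1)) • w.1
        + Real.sinh (Real.arcosh (lorentzForm x.1 w.1)) • u := by
  have h1 := one_lt_form h
  have hs : 0 < Real.sinh (Real.arcosh (lorentzForm x.1 w.1)) :=
    Real.sinh_pos_iff.2 (Real.arcosh_pos h1)
  have hsq := Real.cosh_sq (Real.arcosh (lorentzForm x.1 w.1))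
  rw [cosh_dist] at hsq ⊢
  refine ⟨(Real.sinh (Real.arcosh (lorentzForm x.1 w.1)))⁻¹ •
    (x.1 - lorentzForm x.1 w.1 • w.1), ?_, ?_, ?_⟩
  · rw [lorentzForm_smul_left, lorentzForm_smul_right, form_residual, hsq]
    field_simp
    ring
  · rw [lorentzForm_smul_left, form_sub_smul_self, mul_zero]
  · rw [smul_inv_smul₀ hs.ne']; abel

lemma exists_polar (hn : 1 ≤ n) (x w : Hyperboloid n) :
    ∃ u, lorentzForm u u = -1 ∧ lorentzForm u w.1 = 0 ∧
      x.1 = Real.cosh (Real.arcosh (lorentzForm x.1 w.1)) • w.1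
        + Real.sinh (Real.arcosh (lorentzForm x.1 w.1)) • u := by
  rcases eq_or_ne x w with rfl | h
  -- With x = w every direction at w will do; one is borrowed from another point.
  · obtain ⟨x', hx'⟩ := exists_ne hn x
    obtain ⟨u, hu, hux, -⟩ := exists_polar_of_ne hx'
    exact ⟨u, hu, hux, by simp [form_self]⟩
  · exact exists_polar_of_ne h

lemma exists_extension (hn : 1 ≤ n) (x w : Hyperboloid n) {r : ℝ} (hr : 0 ≤ r) :
    ∃ y : Hyperboloid n, Real.arcosh (lorentzForm y.1 w.1) = r ∧
      Real.arcosh (lorentzForm x.1 y.1) = Real.arcosh (lorentzForm x.1 w.1) + r := by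
  obtain ⟨u, hu, huw, hpol⟩ := exists_polar hn x w
  have ha := Real.arcosh_nonneg (one_le_form x w)
  set a := Real.arcosh (lorentzForm x.1 w.1)
  have hyw : lorentzForm (Real.cosh r • w.1 - Real.sinh r • u) w.1 = Real.cosh r := by
    rw [lorentzForm_sub_left, lorentzForm_smul_left, lorentzForm_smul_left, huw, form_self]; ring
  have hyy : lorentzForm (Real.cosh r • w.1 - Real.sinh r • u)
      (Real.cosh r • w.1 - Real.sinh r • u) = 1 := by
    simp only [lorentzForm_sub_left, lorentzForm_smul_left, lorentzForm_sub_right,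
      lorentzForm_smul_right, lorentzForm_comm w.1 u, huw, hu, form_self]
    linarith [Real.cosh_sq r]
  refine ⟨⟨_, mem_of_pos hyy (height_pos_of_form_pos hyy w (hyw.symm ▸ Real.cosh_pos r))⟩, ?_, ?_⟩
  · rw [hyw, Real.arcosh_cosh hr]
  · rw [← Real.arcosh_cosh (add_nonneg ha hr), Real.cosh_add, hpol]
    congr 1
    simp only [lorentzForm_add_left, lorentzForm_smul_left, lorentzForm_sub_right,
      lorentzForm_smul_right, lorentzForm_comm w.1 u, huw, hu, form_self]
    ring

lemma exists_lens (p q x₀ : Hyperboloid n) {R : ℝ} (hpq : p ≠ q)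
    (hp₀ : Real.arcosh (lorentzForm x₀.1 p.1) ≤ R) :
    ∃ m : Hyperboloid n, ∃ R' < R, ∀ x : Hyperboloid n, Real.arcosh (lorentzForm x.1 p.1) ≤ R →
      Real.arcosh (lorentzForm x.1 q.1) ≤ R → Real.arcosh (lorentzForm x.1 m.1) ≤ R' := by
  have hR : 0 ≤ R := (Real.arcosh_nonneg (one_le_form x₀ p)).trans hp₀
  have hcosh : ∀ x y : Hyperboloid n, Real.arcosh (lorentzForm x.1 y.1) ≤ R →
      lorentzForm x.1 y.1 ≤ Real.cosh R := by
    intro x y h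
    rw [← cosh_dist, Real.cosh_le_cosh, abs_of_nonneg hR,
      abs_of_nonneg (Real.arcosh_nonneg (one_le_form x y))]
    exact h
  have hα := one_lt_form hpq
  -- N is the Lorentz length of p + q, and N > 2 since p ≠ q; the center is (p + q) / N.
  set N := √(2 + 2 * lorentzForm p.1 q.1) with hN
  have hN2 : 2 < N := (Real.lt_sqrt (by norm_num)).2 (by linarith)
  have hNN : N * N = 2 + 2 * lorentzForm p.1 q.1 := Real.mul_self_sqrt (by linarith)
  have hmm : lorentzForm (N⁻¹ • (p.1 + q.1)) (N⁻¹ • (p.1 + q.1)) = 1 := by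
    simp only [lorentzForm_add_left, lorentzForm_smul_left, lorentzForm_add_right,
      lorentzForm_smul_right, lorentzForm_comm q.1 p.1, form_self]
    field_simp
    linarith
  have hm0 : 0 < (N⁻¹ • (p.1 + q.1)).2 := by
    have h1 := p.2.1
    have h2 := q.2.1
    simp only [Prod.smul_snd, Prod.snd_add, smul_eq_mul]
    positivity
  refine ⟨⟨_, mem_of_pos hmm hm0⟩, Real.arcosh (2 * Real.cosh R / N), ?_, fun x hxp hxq => ?_⟩
  · conv_rhs => rw [← Real.arcosh_cosh hR]
    have := Real.cosh_pos R
    rw [Real.arcosh_lt_arcosh (by positivity) this, div_lt_iff₀ (by linarith)]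
    nlinarith
  · rw [Real.arcosh_le_arcosh (by linarith [one_le_form x ⟨_, mem_of_pos hmm hm0⟩])
      (by have := Real.cosh_pos R; positivity), lorentzForm_smul_right, lorentzForm_add_right,
      div_eq_inv_mul]
    gcongr
    linarith [hcosh x p hxp, hcosh x q hxq]

lemma exists_subseq (z : ℕ → Hyperboloid n) (x₀ : Hyperboloid n) (C : ℝ)
    (hC : ∀ k, Real.arcosh (lorentzForm x₀.1 (z k).1) ≤ C) :
    ∃ z' : Hyperboloid n, ∃ φ : ℕ → ℕ, StrictMono φ ∧ ∀ x : Hyperboloid n,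
      Tendsto (fun k => Real.arcosh (lorentzForm x.1 (z (φ k)).1)) atTop
        (𝓝 (Real.arcosh (lorentzForm x.1 z'.1))) := by
  -- Since ‖z‖ is less than the height t of z, t (t₀ - ‖x₀‖) ≤ 𝓑(x₀, z) ≤ cosh C, where t₀ is the
  -- height of x₀ and norms are of the ℝⁿ parts.
  have hheight : ∀ k, (z k).1.2 ≤ Real.cosh C / (x₀.1.2 - ‖x₀.1.1‖) := by
    intro k
    have h0 := Real.arcosh_nonneg (one_le_form x₀ (z k))
    have h1 : lorentzForm x₀.1 (z k).1 ≤ Real.cosh C := by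
      rw [← cosh_dist, Real.cosh_le_cosh, abs_of_nonneg h0, abs_of_nonneg (h0.trans (hC k))]
      exact hC k
    rw [le_div_iff₀ (by linarith [x₀.norm_lt_height])]
    rw [lorentzForm] at h1
    nlinarith [real_inner_le_norm x₀.1.1 (z k).1.1,
      mul_le_mul_of_nonneg_left (z k).norm_lt_height.le (norm_nonneg x₀.1.1)]
  obtain ⟨a, -, φ, hφ, ha⟩ := tendsto_subseq_of_bounded
    (Metric.isBounded_closedBall (x := (0 : EuclideanSpace ℝ (Fin n) × ℝ))
      (r := Real.cosh C / (x₀.1.2 - ‖x₀.1.1‖))) (x := fun k => (z k).1) (fun k => by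
        rw [mem_closedBall_zero_iff, Prod.norm_def, Real.norm_of_nonneg (by linarith [(z k).2.1])]
        exact max_le ((z k).norm_lt_height.le.trans (hheight k)) (hheight k))
  have hclosed : IsClosed {p : EuclideanSpace ℝ (Fin n) × ℝ |
      1 ≤ p.2 ∧ p.2 ^ 2 - inner ℝ p.1 p.1 = 1} :=
    (isClosed_le continuous_const continuous_snd).inter
      (isClosed_eq (by fun_prop) continuous_const)
  have hmem := hclosed.mem_of_tendsto ha (Eventually.of_forall fun k => (z (φ k)).2)
  refine ⟨⟨a, hmem⟩, φ, hφ, fun x => ?_⟩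
  refine (Real.continuousOn_arcosh _ (one_le_form x ⟨a, hmem⟩)).tendsto.comp
    (tendsto_nhdsWithin_iff.2 ⟨((continuous_lorentzForm_right x.1).tendsto a).comp ha,
      Eventually.of_forall fun k => one_le_form x (z (φ k))⟩)

end Hyperboloid

end Hyperbolic

lemma ballGeometry_hyperbolic {n : ℕ} (hn : 1 ≤ n) (E : ℝ) : BallGeometry .hyperbolic n E where
  self x := (congrArg Real.arcosh (Hyperboloid.form_self x)).trans Real.arcosh_zero
  symm _ _ := congrArg Real.arcosh (lorentzForm_comm _ _)
  triangle x y z := Hyperboloid.arcosh_triangle x y z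
  extend x w _ hr _ _ := Hyperboloid.exists_extension hn x w hr
  lens p q x₀ _ hpq _ hp _ := Hyperboloid.exists_lens p q x₀ hpq hp
  subseq z x₀ C hC := Hyperboloid.exists_subseq z x₀ C hC

lemma nonempty_of_diam_pos {g : Geometry} {n : ℕ} {K : Set (Space g n)} (h : 0 < diam K) :
    K.Nonempty := by
  by_contra hne
  rw [Set.not_nonempty_iff_eq_empty] at hne
  have h0 : distances K = ∅ := Set.eq_empty_of_forall_notMem (by
    rintro t ⟨x, hx, -⟩
    rw [hne] at hx
    exact hx)
  rw [diam, h0, Real.sSup_empty] at h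
  exact h.false

end ConstantCurvature

/-- For a complete set of diameter `D > 0` in `ℝⁿ`, `Sⁿ` (with `D < π / 2`) or `Hⁿ`, the inradius
(largest radius of a ball inside) and the circumradius (smallest radius of a ball around) are
attained and add up to `D`; there is a unique inscribed ball of maximal radius, and its center is
the unique circumcenter. -/
theorem proposition4p5 (g : ConstantCurvature.Geometry) (n : ℕ) (hn : 2 ≤ n)
    (K : Set (ConstantCurvature.Space g n)) (D : ℝ) (hD : 0 < D)
    (hSphere : g = ConstantCurvature.Geometry.spherical → D < Real.pi / 2)
    (hK : ConstantCurvature.IsDiamComplete K) (hdiam : ConstantCurvature.diam K = D) :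
    IsLeast (ConstantCurvature.outerRadii K) (ConstantCurvature.circumradius K) ∧
    IsGreatest (ConstantCurvature.innerRadii K) (ConstantCurvature.inradius K) ∧
    ConstantCurvature.circumradius K + ConstantCurvature.inradius K = D ∧
    ∃ p : ConstantCurvature.Space g n,
      ConstantCurvature.IsCircumcenter K p ∧
      (∀ q, ConstantCurvature.IsCircumcenter K q → q = p) ∧
      ConstantCurvature.IsIncenter K p ∧
      (∀ w, ConstantCurvature.IsIncenter K w → w = p) := by
  subst hdiam
  have hne := ConstantCurvature.nonempty_of_diam_pos hD
  have hn1 : 1 ≤ n := by omega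
  cases g with
  | euclidean =>
    exact (ConstantCurvature.ballGeometry_euclidean hn1
      (ConstantCurvature.diam K + 1)).circumradius_add_inradius hK hne (lt_add_one _)
  | spherical =>
    exact (ConstantCurvature.ballGeometry_spherical hn1).circumradius_add_inradius hK hne
      (hSphere rfl)
  | hyperbolic =>
    exact (ConstantCurvature.ballGeometry_hyperbolic hn1
      (ConstantCurvature.diam K + 1)).circumradius_add_inradius hK hne (lt_add_one _)
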